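/- For $\nu\in\mathbb{C}$ let $J_\nu(z)=\sum_{m=0}^\infty \frac{(-1)^m}{m!\,\Gamma(m+\nu+1)}\left(\frac z2\right)^{2m+\nu}$ denote the Bessel function of the first kind, and let ${}_2F_1$ denote the Gauss hypergeometric function. Let $a,b>0$ be real, let $\nu\in\mathbb{C}$ with $\operatorname{Re}\nu>-\tfrac12$, and let $p\in\mathbb{C}\setminus\{0\}$ with $|\arg p|<\pi/4$. Then the integral $\int_0^\infty x e^{-px^2}J_\nu(ax^2)J_\nu(bx^2)\,dx$ converges absolutely, and $$\int_0^\infty x e^{-px^2}J_\nu(ax^2)J_\nu(bx^2)\,dx=\frac{1}{2\sqrt\pi}\,\frac{1}{\sqrt{a^2+b^2+p^2}}\,\frac{\Gamma(\frac12+\nu)}{\Gamma(1+\nu)}\left(\frac{ab}{a^2+b^2+p^2}\right)^{\nu}{}_2F_1\!\left(\frac{1+2\nu}{4},\frac{3+2\nu}{4};1+\nu;\left(\frac{2ab}{a^2+b^2+p^2}\right)^2\right),$$ where the square root and the powers are taken with their principal values (note that $\operatorname{Re}(a^2+b^2+p^2)>0$ and $|2ab/(a^2+b^2+p^2)|<1$).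 -/

import Mathlib

/-- The Bessel function of the first kind of complex order `ν`, defined by its series
`J_ν(z) = ∑ₘ (-1)^m / (m! Γ(m + ν + 1)) (z / 2)^(2m + ν)`, with the principal branch of the power.
At a pole of `Γ` the coefficient is `0`, as it should be, since Mathlib sets `Γ = 0` there. -/
noncomputable def besselJ (ν z : ℂ) : ℂ :=
  ∑' m : ℕ, (-1 : ℂ) ^ m / ((m.factorial : ℂ) * Complex.Gamma ((m : ℂ) + ν + 1)) *
    (z / 2) ^ (2 * (m : ℂ) + ν)

/-! Substituting `t = x ^ 2` turns the integral into half the Laplace transform of `J_ν(a t) J_ν(b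
t)` at `p`. Poisson's integral bounds `(t / 2) ^ (-ν) J_ν(t)` uniformly, so the product is `O(t ^ (2
Re ν))` and the transform is holomorphic for `Re p > 0`.

For large real `p` both Bessel series are integrated term by term
(`hasSum_integral_reducedBesselTerm`). With `α = ν + 1/2`, `c = ν + 1`, `x = -(a/p)²`, `y =
-(b/p)²`, this gives the Appell series `F₄(α, c; c, c; x, y)`, up to a factor. By Chu–Vandermonde it
collapses (`hasSum_double_risingFactorial`) to `(1-x-y)^(-α) ₂F₁(α/2, (α+1)/2; c; 4xy/(1-x-y)²)`,
and `1-x-y = (a²+b²+p²)/p²`.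

Both sides are holomorphic on the sector `|Im p| < Re p`, so the identity theorem extends the
formula from large real `p` to the whole sector (`laplace_besselJ_mul_besselJ`). -/

open MeasureTheory Set Filter Topology

/-! ### Poisson's integral and bounds for the Bessel function -/

/-- The `m`-th term of the entire part `t ↦ (t / 2) ^ (-ν) J_ν(t)` of the Bessel function. -/
noncomputable def reducedBesselTerm (ν : ℂ) (m : ℕ) (t : ℝ) : ℂ :=
  (-1 : ℂ) ^ m / ((m.factorial : ℂ) * Complex.Gamma ((m : ℂ) + ν + 1)) * ((t : ℂ) / 2) ^ (2 * m)

/-- The entire part `t ↦ (t / 2) ^ (-ν) J_ν(t)` of the Bessel function, at real arguments. -/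
noncomputable def reducedBessel (ν : ℂ) (t : ℝ) : ℂ :=
  ∑' m : ℕ, reducedBesselTerm ν m t

/-- The weight `x ^ (-1/2) (1 - x) ^ (ν - 1/2)` of the Poisson integral. -/
noncomputable def poissonWeight (ν : ℂ) (x : ℝ) : ℂ :=
  (x : ℂ) ^ (1 / 2 - 1 : ℂ) * (1 - (x : ℂ)) ^ (ν + 1 / 2 - 1)

lemma integrableOn_poissonWeight {ν : ℂ} (hν : -(1 / 2 : ℝ) < ν.re) :
    IntegrableOn (poissonWeight ν) (Ioc 0 1) := by
  have h := Complex.betaIntegral_convergent (u := 1 / 2) (v := ν + 1 / 2)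
    (by norm_num) (by norm_num at hν ⊢; linarith)
  rwa [intervalIntegrable_iff_integrableOn_Ioc_of_le zero_le_one] at h

lemma betaIntegral_natCast_add_half (ν : ℂ) (m : ℕ) :
    Complex.betaIntegral (m + 1 / 2) (ν + 1 / 2) =
      ∫ x in Ioc (0 : ℝ) 1, (x : ℂ) ^ m * poissonWeight ν x := by
  rw [Complex.betaIntegral, intervalIntegral.integral_of_le zero_le_one]
  refine setIntegral_congr_fun measurableSet_Ioc fun x hx => ?_
  have hx0 : (x : ℂ) ≠ 0 := by exact_mod_cast hx.1.ne'
  simp only [poissonWeight]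
  rw [show (m : ℂ) + 1 / 2 - 1 = m + (1 / 2 - 1) by ring, Complex.cpow_add _ _ hx0,
    Complex.cpow_natCast, mul_assoc]

/-- The beta integral `B(m + 1/2, ν + 1/2)` produces `1 / Γ(m + ν + 1)`, and the duplication formula
at `m + 1/2` trades `m! 4 ^ m` for `(2m)!`. What remains is the cosine series in `t √x` under the
integral. -/
lemma reducedBesselTerm_eq {ν : ℂ} (hν : -(1 / 2 : ℝ) < ν.re) (t : ℝ) (m : ℕ) :
    reducedBesselTerm ν m t =
    ((√Real.pi : ℂ) * Complex.Gamma (ν + 1 / 2))⁻¹ *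
      ∫ x in Ioc (0 : ℝ) 1, ((-1 : ℂ) ^ m * (t : ℂ) ^ (2 * m) / ((2 * m).factorial : ℂ)) *
        ((x : ℂ) ^ m * poissonWeight ν x) := by
  have hre : 0 < (ν + 1 / 2).re := by norm_num at hν ⊢; linarith
  rw [reducedBesselTerm, integral_const_mul, ← betaIntegral_natCast_add_half]
  have hB := Complex.Gamma_mul_Gamma_eq_betaIntegral (s := m + 1 / 2) (t := ν + 1 / 2)
    (by norm_num; positivity) hre
  have hD := Complex.Gamma_mul_Gamma_add_half ((m : ℂ) + 1 / 2)
  rw [show (m : ℂ) + 1 / 2 + 1 / 2 = m + 1 by ring,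
    show 2 * ((m : ℂ) + 1 / 2) = (2 * m : ℕ) + 1 by push_cast; ring, Complex.Gamma_nat_eq_factorial,
    Complex.Gamma_nat_eq_factorial,
    show (1 : ℂ) - ((2 * m : ℕ) + 1) = -((2 * m : ℕ) : ℂ) by ring, Complex.cpow_neg,
    Complex.cpow_natCast] at hD
  rw [show (m : ℂ) + 1 / 2 + (ν + 1 / 2) = m + ν + 1 by ring] at hB
  have h1 : Complex.Gamma (ν + 1 / 2) ≠ 0 := Complex.Gamma_ne_zero_of_re_pos hre
  have h2 : Complex.Gamma (m + ν + 1) ≠ 0 := Complex.Gamma_ne_zero_of_re_pos (by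
    have : (0 : ℝ) ≤ m := m.cast_nonneg
    norm_num at hν ⊢; linarith)
  have h3 : (m.factorial : ℂ) ≠ 0 := by exact_mod_cast m.factorial_ne_zero
  have h4 : ((2 * m).factorial : ℂ) ≠ 0 := by exact_mod_cast (2 * m).factorial_ne_zero
  have h5 : (√Real.pi : ℂ) ≠ 0 := by
    exact_mod_cast (Real.sqrt_pos.2 Real.pi_pos).ne'
  have hB' : Complex.betaIntegral (m + 1 / 2) (ν + 1 / 2) =
      Complex.Gamma (m + 1 / 2) * Complex.Gamma (ν + 1 / 2) / Complex.Gamma (m + ν + 1) := by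
    rw [eq_div_iff h2, hB]; ring
  have hD' : Complex.Gamma (m + 1 / 2) =
      ((2 * m).factorial : ℂ) * ((2 : ℂ) ^ (2 * m))⁻¹ * √Real.pi / (m.factorial : ℂ) := by
    rw [eq_div_iff h3, hD]
  rw [hB', hD', div_pow]
  generalize Complex.Gamma (ν + 1 / 2) = G at h1 ⊢
  field_simp

lemma integral_norm_reducedBesselTerm_le {ν : ℂ} (hν : -(1 / 2 : ℝ) < ν.re) (t : ℝ) (m : ℕ) :
    ∫ x in Ioc (0 : ℝ) 1, ‖((-1 : ℂ) ^ m * (t : ℂ) ^ (2 * m) / ((2 * m).factorial : ℂ)) *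
        ((x : ℂ) ^ m * poissonWeight ν x)‖ ≤
      (|t| ^ (2 * m) / (2 * m).factorial) * ∫ x in Ioc (0 : ℝ) 1, ‖poissonWeight ν x‖ := by
  rw [← integral_const_mul]
  refine integral_mono_of_nonneg (ae_of_all _ fun _ => norm_nonneg _)
    ((integrableOn_poissonWeight hν).norm.const_mul _) ?_
  refine (ae_restrict_iff' measurableSet_Ioc).2 (ae_of_all _ fun x hx => ?_)
  simp only [norm_mul, norm_div, norm_pow, norm_neg, norm_one, one_pow, one_mul,
    Complex.norm_real, Real.norm_eq_abs, Complex.norm_natCast]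
  gcongr
  refine mul_le_of_le_one_left (norm_nonneg _) (pow_le_one₀ (abs_nonneg _) ?_)
  rw [abs_of_pos hx.1]; exact hx.2

lemma summable_abs_pow_div_factorial (t : ℝ) :
    Summable fun m : ℕ => |t| ^ (2 * m) / (2 * m).factorial :=
  (Real.hasSum_cosh |t|).summable

/-- Majorant of the terms of `reducedBessel`, uniform in the argument. -/
noncomputable def reducedBesselBound (ν : ℂ) : ℝ :=
  ‖((√Real.pi : ℂ) * Complex.Gamma (ν + 1 / 2))⁻¹‖ * ∫ x in Ioc (0 : ℝ) 1, ‖poissonWeight ν x‖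

lemma reducedBesselBound_nonneg (ν : ℂ) : 0 ≤ reducedBesselBound ν :=
  mul_nonneg (norm_nonneg _) (integral_nonneg fun _ => norm_nonneg _)

lemma norm_reducedBesselTerm_le {ν : ℂ} (hν : -(1 / 2 : ℝ) < ν.re) (t : ℝ) (m : ℕ) :
    ‖reducedBesselTerm ν m t‖ ≤
    reducedBesselBound ν * (|t| ^ (2 * m) / (2 * m).factorial) := by
  rw [reducedBesselTerm_eq hν, norm_mul, reducedBesselBound, mul_assoc]
  refine mul_le_mul_of_nonneg_left ?_ (norm_nonneg _)
  refine (norm_integral_le_integral_norm _).trans ?_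
  rw [mul_comm (∫ x in Ioc (0 : ℝ) 1, ‖poissonWeight ν x‖)]
  exact integral_norm_reducedBesselTerm_le hν t m

lemma integrable_reducedBesselTerm {ν : ℂ} (hν : -(1 / 2 : ℝ) < ν.re) (t : ℝ) (m : ℕ) :
    IntegrableOn (fun x : ℝ => ((-1 : ℂ) ^ m * (t : ℂ) ^ (2 * m) / ((2 * m).factorial : ℂ)) *
        ((x : ℂ) ^ m * poissonWeight ν x)) (Ioc 0 1) := by
  refine Integrable.const_mul ?_ _
  refine (integrableOn_poissonWeight hν).bdd_mul (c := 1)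
    (Continuous.aestronglyMeasurable (by fun_prop)) ?_
  refine (ae_restrict_iff' measurableSet_Ioc).2 (ae_of_all _ fun x hx => ?_)
  rw [norm_pow, Complex.norm_real, Real.norm_eq_abs, abs_of_pos hx.1]
  exact pow_le_one₀ hx.1.le hx.2

lemma summable_norm_reducedBesselTerm {ν : ℂ} (hν : -(1 / 2 : ℝ) < ν.re) (t : ℝ) :
    Summable fun m : ℕ =>
      ‖reducedBesselTerm ν m t‖ :=
  Summable.of_nonneg_of_le (fun _ => norm_nonneg _) (norm_reducedBesselTerm_le hν t)
    ((summable_abs_pow_div_factorial t).mul_left _)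

/-- Poisson's integral for the Bessel function. -/
lemma reducedBessel_eq_integral {ν : ℂ} (hν : -(1 / 2 : ℝ) < ν.re) (t : ℝ) :
    reducedBessel ν t = ((√Real.pi : ℂ) * Complex.Gamma (ν + 1 / 2))⁻¹ *
      ∫ x in Ioc (0 : ℝ) 1, (Real.cos (t * √x) : ℂ) * poissonWeight ν x := by
  have h := hasSum_integral_of_summable_integral_norm
    (integrable_reducedBesselTerm hν t)
    (Summable.of_nonneg_of_le (fun _ => integral_nonneg fun _ => norm_nonneg _)
      (integral_norm_reducedBesselTerm_le hν t)
      ((summable_abs_pow_div_factorial t).mul_right _))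
  rw [reducedBessel, tsum_congr (reducedBesselTerm_eq hν t), tsum_mul_left, h.tsum_eq]
  congr 1
  refine setIntegral_congr_fun measurableSet_Ioc fun x hx => ?_
  have hc := ((Complex.hasSum_ofReal.2 (Real.hasSum_cos (t * √x))).mul_right
    (poissonWeight ν x)).tsum_eq
  rw [← hc]
  refine tsum_congr fun m => ?_
  have : (√x : ℂ) ^ (2 * m) = (x : ℂ) ^ m := by
    rw [pow_mul, ← Complex.ofReal_pow, Real.sq_sqrt hx.1.le]
  push_cast
  rw [mul_pow, this]
  ring

/-- `|cos| ≤ 1` captures the cancellation in the series; the termwise bounds sum only to a multiple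
of `cosh t`, which would restrict the Laplace transform to large `Re p`. -/
lemma norm_reducedBessel_le {ν : ℂ} (hν : -(1 / 2 : ℝ) < ν.re) (t : ℝ) :
    ‖reducedBessel ν t‖ ≤ reducedBesselBound ν := by
  rw [reducedBessel_eq_integral hν, norm_mul, reducedBesselBound]
  refine mul_le_mul_of_nonneg_left ?_ (norm_nonneg _)
  refine (norm_integral_le_integral_norm _).trans ?_
  refine integral_mono_of_nonneg (ae_of_all _ fun _ => norm_nonneg _)
    (integrableOn_poissonWeight hν).norm (ae_of_all _ fun x => ?_)
  simp only [norm_mul, Complex.norm_real, Real.norm_eq_abs]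
  exact mul_le_of_le_one_left (norm_nonneg _) (Real.abs_cos_le_one _)

lemma measurable_reducedBessel {ν : ℂ} (hν : -(1 / 2 : ℝ) < ν.re) :
    Measurable (reducedBessel ν) := by
  refine measurable_of_tendsto_metrizable (f := fun n (t : ℝ) => ∑ m ∈ Finset.range n,
    reducedBesselTerm ν m t) (fun n => Continuous.measurable (by unfold reducedBesselTerm; fun_prop)) ?_
  rw [tendsto_pi_nhds]
  exact fun t => (summable_norm_reducedBesselTerm hν t).of_norm.hasSum.tendsto_sum_nat

lemma besselJ_ofReal (ν : ℂ) {t : ℝ} (ht : 0 < t) :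
    besselJ ν t = ((t : ℂ) / 2) ^ ν * reducedBessel ν t := by
  have h0 : (t : ℂ) / 2 ≠ 0 := by
    have : (t : ℂ) ≠ 0 := by exact_mod_cast ht.ne'
    exact div_ne_zero this two_ne_zero
  rw [besselJ, reducedBessel, ← tsum_mul_left]
  refine tsum_congr fun m => ?_
  rw [reducedBesselTerm, Complex.cpow_add _ _ h0, show (2 * (m : ℂ)) = ((2 * m : ℕ) : ℂ) by push_cast; ring,
    Complex.cpow_natCast]
  ring

/-! ### Rising factorials and Chu–Vandermonde -/

/-- The rising factorial `(c)_n = c (c + 1) ⋯ (c + n - 1)`. -/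
noncomputable def risingFactorial (c : ℂ) (n : ℕ) : ℂ := (ascPochhammer ℂ n).eval c

@[simp] lemma risingFactorial_zero (c : ℂ) : risingFactorial c 0 = 1 := by
  simp [risingFactorial]

lemma risingFactorial_succ (c : ℂ) (n : ℕ) :
    risingFactorial c (n + 1) = risingFactorial c n * (c + n) := by
  simp [risingFactorial, ascPochhammer_succ_eval]

lemma risingFactorial_add (c : ℂ) (m n : ℕ) :
    risingFactorial c (m + n) = risingFactorial c m * risingFactorial (c + m) n := by
  induction n with
  | zero => simp
  | succ n ih => rw [← add_assoc, risingFactorial_succ, ih, risingFactorial_succ]; push_cast; ring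

/-- This duplication formula is the source of the halved parameters in the hypergeometric function.
-/
lemma risingFactorial_two_mul (c : ℂ) (k : ℕ) :
    risingFactorial c (2 * k) =
      risingFactorial (c / 2) k * risingFactorial ((c + 1) / 2) k * 4 ^ k := by
  induction k with
  | zero => simp
  | succ k ih =>
    rw [show 2 * (k + 1) = 2 * k + 1 + 1 by ring, risingFactorial_succ, risingFactorial_succ, ih,
      risingFactorial_succ, risingFactorial_succ]
    push_cast; ring

lemma Gamma_add_natCast {c : ℂ} (hc : 0 < c.re) (n : ℕ) :
    Complex.Gamma (c + n) = risingFactorial c n * Complex.Gamma c := by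
  induction n with
  | zero => simp
  | succ n ih =>
    have h0 : c + n ≠ 0 := fun h => by
      have := congrArg Complex.re h
      simp at this
      have : (0 : ℝ) ≤ n := n.cast_nonneg
      linarith
    rw [Nat.cast_succ, ← add_assoc, Complex.Gamma_add_one _ h0, ih, risingFactorial_succ]; ring

lemma norm_risingFactorial_le {c : ℂ} {r : ℕ} (hr : ‖c‖ ≤ r) (n : ℕ) :
    ‖risingFactorial c n‖ ≤ 2 ^ (r + n) * n.factorial := by
  have h : ‖risingFactorial c n‖ ≤ ((r + 1).ascFactorial n : ℕ) := by
    induction n with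
    | zero => simp
    | succ n ih =>
      rw [risingFactorial_succ, norm_mul, Nat.ascFactorial_succ, mul_comm (r + 1 + n)]
      push_cast
      gcongr
      refine (norm_add_le _ _).trans ?_
      rw [Complex.norm_natCast]
      linarith
  refine h.trans ?_
  rw [Nat.ascFactorial_eq_factorial_mul_choose, mul_comm]
  push_cast
  gcongr
  exact_mod_cast Nat.choose_le_two_pow (r + n) n

/-- Each factor satisfies `|c + n| ≥ n + 1/2 ≥ (n + 1) / 2`. The case of interest is `c = ν + 1`,
where `Re c > 1/2`. -/
lemma factorial_le_norm_risingFactorial {c : ℂ} (hc : 1 / 2 < c.re) (n : ℕ) :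
    (n.factorial : ℝ) ≤ 2 ^ n * ‖risingFactorial c n‖ := by
  induction n with
  | zero => simp
  | succ n ih =>
    rw [risingFactorial_succ, norm_mul, Nat.factorial_succ]
    have h1 : ((n : ℝ) + 1) ≤ 2 * ‖c + n‖ := by
      have h2 := Complex.re_le_norm (c + n)
      simp at h2
      have : (0 : ℝ) ≤ n := n.cast_nonneg
      linarith
    push_cast
    calc ((n : ℝ) + 1) * n.factorial ≤ (2 * ‖c + n‖) * (2 ^ n * ‖risingFactorial c n‖) := by gcongr
      _ = _ := by ring

lemma risingFactorial_ne_zero {c : ℂ} (hc : 1 / 2 < c.re) (n : ℕ) : risingFactorial c n ≠ 0 := by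
  intro h
  have := factorial_le_norm_risingFactorial hc n
  rw [h, norm_zero, mul_zero] at this
  exact absurd this (not_le.2 (by exact_mod_cast n.factorial_pos))

lemma choose_eq_risingFactorial (c : ℂ) (n : ℕ) :
    Ring.choose (c + n - 1) n = risingFactorial c n / n.factorial := by
  have h := Ring.factorial_nsmul_multichoose_eq_ascPochhammer c n
  rw [Polynomial.ascPochhammer_smeval_eq_eval, nsmul_eq_mul] at h
  rw [eq_div_iff (by exact_mod_cast n.factorial_ne_zero), risingFactorial, ← h,
    Ring.multichoose_eq, mul_comm]

/-- The Chu–Vandermonde identity. -/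
lemma sum_choose_mul_risingFactorial (c : ℂ) (m n : ℕ) :
    ∑ k ∈ Finset.range (n + 1),
      (m.choose k : ℂ) * (risingFactorial (c + k) (n - k) / (n - k).factorial) =
    risingFactorial (c + m) n / n.factorial := by
  -- The binomial form of Vandermonde applies to the upper argument split as `m + (c + n - 1)`.
  rw [← choose_eq_risingFactorial, show c + m + n - 1 = (m : ℂ) + (c + n - 1) by ring,
    Ring.add_choose_eq _ (Commute.all _ _), Finset.Nat.sum_antidiagonal_eq_sum_range_succ_mk]
  refine Finset.sum_congr rfl fun k hk => ?_
  have hk' : k ≤ n := Nat.lt_succ_iff.1 (Finset.mem_range.1 hk)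
  rw [← choose_eq_risingFactorial, Ring.choose_natCast, Nat.cast_sub hk']
  congr 3
  ring

/-- Chu–Vandermonde divided by `m! (c)_n`, using `(c)_n = (c)_k (c + k)_(n-k)`. The `if` discards
the terms where the truncated `m - k` would be spurious. -/
lemma sum_inv_factorial_risingFactorial {c : ℂ} (hc : 1 / 2 < c.re) (m n : ℕ) :
    ∑ k ∈ Finset.range (n + 1), (if k ≤ m then
      (1 : ℂ) / ((m - k).factorial * (n - k).factorial * k.factorial * risingFactorial c k)
      else 0) =
    risingFactorial c (m + n) /
      (m.factorial * n.factorial * risingFactorial c m * risingFactorial c n) := by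
  have hm := risingFactorial_ne_zero hc m
  have hn := risingFactorial_ne_zero hc n
  have hmf : (m.factorial : ℂ) ≠ 0 := by exact_mod_cast m.factorial_ne_zero
  have hnf : (n.factorial : ℂ) ≠ 0 := by exact_mod_cast n.factorial_ne_zero
  have key := sum_choose_mul_risingFactorial c m n
  rw [show risingFactorial c (m + n) /
      (m.factorial * n.factorial * risingFactorial c m * risingFactorial c n) =
      (1 / (m.factorial * risingFactorial c n)) * (risingFactorial (c + m) n / n.factorial) by
    rw [risingFactorial_add]; field_simp, ← key, Finset.mul_sum]
  refine Finset.sum_congr rfl fun k hk => ?_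
  have hk' : k ≤ n := Nat.lt_succ_iff.1 (Finset.mem_range.1 hk)
  split_ifs with h
  · have e1 := risingFactorial_add c k (n - k)
    rw [Nat.add_sub_cancel' hk'] at e1
    have hk0 := risingFactorial_ne_zero hc k
    have e2 : risingFactorial (c + k) (n - k) ≠ 0 := fun h0 => hn (by rw [e1, h0, mul_zero])
    rw [Nat.cast_choose ℂ h, e1]
    have f1 : ((m - k).factorial : ℂ) ≠ 0 := by exact_mod_cast (m - k).factorial_ne_zero
    have f2 : ((n - k).factorial : ℂ) ≠ 0 := by exact_mod_cast (n - k).factorial_ne_zero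
    have f3 : (k.factorial : ℂ) ≠ 0 := by exact_mod_cast k.factorial_ne_zero
    field_simp
  · rw [Nat.choose_eq_zero_of_lt (by omega)]; simp

/-! ### Reduction of the double series to a single one -/

/-- The binomial series. -/
lemma hasSum_risingFactorial_mul_pow (c : ℂ) {z : ℂ} (hz : ‖z‖ < 1) :
    HasSum (fun n : ℕ => risingFactorial c n / n.factorial * z ^ n) ((1 - z) ^ (-c)) := by
  have h := (Complex.one_div_one_sub_cpow_hasFPowerSeriesOnBall_zero c).hasSum (y := z)
    (by simpa [enorm_eq_nnnorm] using (by exact_mod_cast hz : ‖z‖₊ < 1))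
  simpa [choose_eq_risingFactorial, Complex.cpow_neg, FormalMultilinearSeries.ofScalars_apply_eq,
    mul_comm] using h

lemma factorial_two_mul_add_add_le (k i j : ℕ) :
    (2 * k + (i + j)).factorial ≤
      4 ^ (2 * k + (i + j)) * (i.factorial * j.factorial * (k.factorial * k.factorial)) := by
  have h1 := Nat.add_choose_mul_factorial_mul_factorial (2 * k) (i + j)
  have h2 := Nat.add_choose_mul_factorial_mul_factorial k k
  have h3 := Nat.add_choose_mul_factorial_mul_factorial i j
  have c1 := Nat.choose_le_two_pow (2 * k + (i + j)) (i + j)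
  have c2 := Nat.choose_le_two_pow (k + k) k
  have c3 := Nat.choose_le_two_pow (i + j) j
  rw [← h1, two_mul k, ← h2, ← h3, ← two_mul k]
  rw [← two_mul] at c2
  calc (2 * k + (i + j)).choose (i + j) * ((2 * k).choose k * k.factorial * k.factorial) *
        ((i + j).choose j * i.factorial * j.factorial)
      ≤ 2 ^ (2 * k + (i + j)) * (2 ^ (2 * k) * k.factorial * k.factorial) *
        (2 ^ (i + j) * i.factorial * j.factorial) := by gcongr
    _ = (2 * 2) ^ (2 * k + (i + j)) *
        (i.factorial * j.factorial * (k.factorial * k.factorial)) := by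
      rw [mul_pow]; ring

/-- The terms of the expansion of `∑ₖ (α)₂ₖ / (k! (c)ₖ) (x y)ᵏ (1 - x - y) ^ (-α - 2 k)` in powers
of `x` and `y`. -/
noncomputable def kummerTerm (α c x y : ℂ) (q : ℕ × ℕ × ℕ) : ℂ :=
  risingFactorial α (2 * q.1 + (q.2.1 + q.2.2)) /
    (q.2.1.factorial * q.2.2.factorial * q.1.factorial * risingFactorial c q.1) *
    x ^ (q.1 + q.2.1) * y ^ (q.1 + q.2.2)

/-- The numerator costs `2 ^ (r + N) N!` with `N = 2k + i + j`, and `N!` costs `4 ^ N` against the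
factorials below, hence `8 ^ N`; replacing `k!` by `(c)_k` costs `2 ^ k`. So `128 = 8² · 2`, and for
`|x|, |y| < 1/16` all three geometric ratios are below `1/2`. -/
lemma norm_kummerTerm_le {α c x y : ℂ} {r : ℕ} (hr : ‖α‖ ≤ r) (hc : 1 / 2 < c.re)
    (q : ℕ × ℕ × ℕ) :
    ‖kummerTerm α c x y q‖ ≤
      2 ^ r * ((128 * ‖x‖ * ‖y‖) ^ q.1 * ((8 * ‖x‖) ^ q.2.1 * (8 * ‖y‖) ^ q.2.2)) := by
  obtain ⟨k, i, j⟩ := q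
  have h1 := norm_risingFactorial_le hr (2 * k + (i + j))
  have h2 := factorial_le_norm_risingFactorial hc k
  have h3 : ((2 * k + (i + j)).factorial : ℝ) ≤
      4 ^ (2 * k + (i + j)) * (i.factorial * j.factorial * (k.factorial * k.factorial)) := by
    exact_mod_cast factorial_two_mul_add_add_le k i j
  have h0 : 0 < ‖risingFactorial c k‖ := norm_pos_iff.2 (risingFactorial_ne_zero hc k)
  simp only [kummerTerm, norm_mul, norm_div, norm_pow, Complex.norm_natCast]
  have h4 : ‖risingFactorial α (2 * k + (i + j))‖ /
      (i.factorial * j.factorial * k.factorial * ‖risingFactorial c k‖) ≤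
      2 ^ r * 8 ^ (2 * k + (i + j)) * 2 ^ k := by
    rw [div_le_iff₀ (by positivity)]
    calc _ ≤ (2 : ℝ) ^ (r + (2 * k + (i + j))) * (4 ^ (2 * k + (i + j)) *
          (i.factorial * j.factorial * (k.factorial * k.factorial))) := h1.trans (by gcongr)
      _ ≤ 2 ^ (r + (2 * k + (i + j))) * (4 ^ (2 * k + (i + j)) *
          (i.factorial * j.factorial * (k.factorial * (2 ^ k * ‖risingFactorial c k‖)))) := by
        gcongr
      _ = 2 ^ r * (2 * 4) ^ (2 * k + (i + j)) * 2 ^ k *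
          (i.factorial * j.factorial * k.factorial * ‖risingFactorial c k‖) := by
        rw [mul_pow, pow_add 2 r]; ring
      _ = _ := by norm_num
  calc _ ≤ 2 ^ r * 8 ^ (2 * k + (i + j)) * 2 ^ k * ‖x‖ ^ (k + i) * ‖y‖ ^ (k + j) := by gcongr
    _ = 2 ^ r * ((8 ^ 2 * 2 * ‖x‖ * ‖y‖) ^ k * ((8 * ‖x‖) ^ i * (8 * ‖y‖) ^ j)) := by
      simp only [mul_pow, pow_add, pow_mul]; ring
    _ = _ := by norm_num

lemma summable_norm_kummerTerm (α : ℂ) {c x y : ℂ} (hc : 1 / 2 < c.re)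
    (hx : ‖x‖ < 1 / 16) (hy : ‖y‖ < 1 / 16) :
    Summable fun q => ‖kummerTerm α c x y q‖ := by
  obtain ⟨r, hr⟩ := exists_nat_ge ‖α‖
  refine Summable.of_nonneg_of_le (fun _ => norm_nonneg _) (norm_kummerTerm_le hr hc)
    (Summable.mul_left _ ?_)
  have hx0 := norm_nonneg x
  have hy0 := norm_nonneg y
  have g1 : Summable fun k : ℕ => (128 * ‖x‖ * ‖y‖) ^ k :=
    summable_geometric_of_lt_one (by positivity) (by nlinarith)
  have g2 : Summable fun k : ℕ => (8 * ‖x‖) ^ k :=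
    summable_geometric_of_lt_one (by positivity) (by linarith)
  have g3 : Summable fun k : ℕ => (8 * ‖y‖) ^ k :=
    summable_geometric_of_lt_one (by positivity) (by linarith)
  exact g1.mul_of_nonneg (g2.mul_of_nonneg g3 (fun _ => by positivity) fun _ => by positivity)
    (fun _ => by positivity) fun _ => by positivity

/-- Expansion of `(1 - x - y) ^ (-c)` in powers of `x` and `y`. -/
lemma hasSum_risingFactorial_mul_pow_mul_pow {c x y : ℂ} (hxy : ‖x + y‖ < 1)
    (hs : Summable fun q : ℕ × ℕ =>
      risingFactorial c (q.1 + q.2) / (q.1.factorial * q.2.factorial) * x ^ q.1 * y ^ q.2) :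
    HasSum (fun q : ℕ × ℕ =>
      risingFactorial c (q.1 + q.2) / (q.1.factorial * q.2.factorial) * x ^ q.1 * y ^ q.2)
      ((1 - (x + y)) ^ (-c)) := by
  -- Grouping by total degree `n` turns the inner sums into `(x + y) ^ n` and leaves the
  -- one-variable binomial series.
  have h1 := (Finset.HasAntidiagonal.sigmaAntidiagonalEquivProd (A := ℕ)).hasSum_iff.2 hs.hasSum
  have h2 := h1.sigma fun n => hasSum_fintype _
  have h3 := hasSum_risingFactorial_mul_pow c hxy
  have h4 : (fun n : ℕ => ∑ q : Finset.HasAntidiagonal.antidiagonal n, ((fun q : ℕ × ℕ =>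
      risingFactorial c (q.1 + q.2) / (q.1.factorial * q.2.factorial) * x ^ q.1 * y ^ q.2) ∘
      Finset.HasAntidiagonal.sigmaAntidiagonalEquivProd) ⟨n, q⟩) =
      fun n : ℕ => risingFactorial c n / n.factorial * (x + y) ^ n := by
    funext n
    rw [(Commute.all x y).add_pow', Finset.mul_sum]
    simp only [Function.comp, Finset.HasAntidiagonal.sigmaAntidiagonalEquivProd_apply]
    rw [Finset.sum_coe_sort (Finset.HasAntidiagonal.antidiagonal n) fun q : ℕ × ℕ =>
      risingFactorial c (q.1 + q.2) / (q.1.factorial * q.2.factorial) * x ^ q.1 * y ^ q.2]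
    refine Finset.sum_congr rfl fun q hq => ?_
    have hq' := Finset.HasAntidiagonal.mem_antidiagonal.1 hq
    have hle : q.1 ≤ n := by omega
    have h5 : n - q.1 = q.2 := by omega
    rw [hq', nsmul_eq_mul, Nat.cast_choose ℂ hle, h5]
    have f1 : (n.factorial : ℂ) ≠ 0 := by exact_mod_cast n.factorial_ne_zero
    have f2 : (q.1.factorial : ℂ) ≠ 0 := by exact_mod_cast q.1.factorial_ne_zero
    have f3 : (q.2.factorial : ℂ) ≠ 0 := by exact_mod_cast q.2.factorial_ne_zero
    field_simp
  rw [h4] at h2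
  rw [h3.unique h2]
  exact hs.hasSum

/-- Since `(α)_(2k+i+j) = (α)_(2k) (α + 2k)_(i+j)`, the sum over `i, j` is a binomial series with
exponent `-(α + 2k)`. -/
lemma hasSum_kummerTerm_fiber (α : ℂ) {c x y : ℂ} (hc : 1 / 2 < c.re)
    (hx : ‖x‖ < 1 / 16) (hy : ‖y‖ < 1 / 16) (k : ℕ) :
    HasSum (fun q : ℕ × ℕ => kummerTerm α c x y (k, q))
      (risingFactorial α (2 * k) / (k.factorial * risingFactorial c k) * (x * y) ^ k *
        (1 - (x + y)) ^ (-(α + (2 * k : ℕ)))) := by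
  have hxy : ‖x + y‖ < 1 := (norm_add_le _ _).trans_lt (by linarith)
  have hs : Summable fun q : ℕ × ℕ => risingFactorial (α + (2 * k : ℕ)) (q.1 + q.2) /
      (q.1.factorial * q.2.factorial) * x ^ q.1 * y ^ q.2 := by
    -- Summability is read off the slice `k = 0` of the triple series with `α + 2k` in place of `α`.
    have h0 := (summable_norm_kummerTerm (α + (2 * k : ℕ)) hc hx hy).of_norm
    have h1 := h0.comp_injective (i := fun q : ℕ × ℕ => ((0 : ℕ), q))
      (fun q q' h => (Prod.mk.inj h).2)
    refine h1.congr fun q => ?_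
    simp [kummerTerm]
  refine ((hasSum_risingFactorial_mul_pow_mul_pow hxy hs).mul_left
    (risingFactorial α (2 * k) / (k.factorial * risingFactorial c k) * (x * y) ^ k)).congr_fun ?_
  intro q
  simp only [kummerTerm]
  rw [risingFactorial_add α (2 * k), mul_pow, pow_add, pow_add]
  have hk0 := risingFactorial_ne_zero hc k
  have f1 : (k.factorial : ℂ) ≠ 0 := by exact_mod_cast k.factorial_ne_zero
  have f2 : (q.1.factorial : ℂ) ≠ 0 := by exact_mod_cast q.1.factorial_ne_zero
  have f3 : (q.2.factorial : ℂ) ≠ 0 := by exact_mod_cast q.2.factorial_ne_zero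
  field_simp

/-- The absolutely convergent triple series is summed in two ways: with `k` fixed it gives the
right-hand side, and with `m = k + i`, `n = k + j` fixed the sum over `k` is evaluated by
Chu–Vandermonde. -/
lemma hasSum_double_risingFactorial (α : ℂ) {c x y : ℂ} (hc : 1 / 2 < c.re)
    (hx : ‖x‖ < 1 / 16) (hy : ‖y‖ < 1 / 16) :
    HasSum (fun q : ℕ × ℕ => risingFactorial α (q.1 + q.2) * risingFactorial c (q.1 + q.2) /
        (q.1.factorial * q.2.factorial * risingFactorial c q.1 * risingFactorial c q.2) *
        x ^ q.1 * y ^ q.2)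
      (∑' k : ℕ, risingFactorial α (2 * k) / (k.factorial * risingFactorial c k) * (x * y) ^ k *
        (1 - (x + y)) ^ (-(α + (2 * k : ℕ)))) := by
  have h0 := (summable_norm_kummerTerm α hc hx hy).of_norm.hasSum
  rw [(h0.prod_fiberwise (hasSum_kummerTerm_fiber α hc hx hy)).tsum_eq]
  let e : ℕ × ℕ × ℕ → (ℕ × ℕ) × ℕ := fun q => ((q.1 + q.2.1, q.1 + q.2.2), q.1)
  have he : Function.Injective e := by
    rintro ⟨k, i, j⟩ ⟨k', i', j'⟩ h
    simp only [e, Prod.mk.injEq] at h ⊢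
    omega
  -- The reindexed family, extended by zero off the range `k ≤ min m n` of `e`.
  let S : (ℕ × ℕ) × ℕ → ℂ := fun q => if q.2 ≤ q.1.1 ∧ q.2 ≤ q.1.2 then
    kummerTerm α c x y (q.2, q.1.1 - q.2, q.1.2 - q.2) else 0
  have hS : HasSum S (∑' q, kummerTerm α c x y q) := by
    refine (he.hasSum_iff ?_).1 ?_
    · rintro ⟨⟨m, n⟩, k⟩ hq
      simp only [S]
      rw [if_neg]
      rintro ⟨h1, h2⟩
      exact hq ⟨(k, m - k, n - k), by simp [e, h1, h2]⟩
    · refine h0.congr_fun ?_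
      rintro ⟨k, i, j⟩
      simp [S, e]
  refine hS.prod_fiberwise ?_
  rintro ⟨m, n⟩
  have hz : ∀ k ∉ Finset.range (n + 1), S ((m, n), k) = 0 := fun k hk => by
    simp only [S]
    rw [if_neg]
    rintro ⟨_, h2⟩
    exact hk (Finset.mem_range.2 (Nat.lt_succ_of_le h2))
  have h1 : HasSum (fun k => S ((m, n), k)) (∑ k ∈ Finset.range (n + 1), S ((m, n), k)) :=
    hasSum_sum_of_ne_finset_zero hz
  convert h1 using 1
  have h2 := sum_inv_factorial_risingFactorial hc m n
  simp only
  rw [mul_div_assoc, ← h2, Finset.mul_sum, Finset.sum_mul, Finset.sum_mul]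
  refine Finset.sum_congr rfl fun k hk => ?_
  have hk' : k ≤ n := Nat.lt_succ_iff.1 (Finset.mem_range.1 hk)
  simp only [S]
  by_cases h : k ≤ m
  · rw [if_pos h, if_pos ⟨h, hk'⟩, kummerTerm]
    simp only
    rw [show 2 * k + (m - k + (n - k)) = m + n by omega, Nat.add_sub_cancel' h,
      Nat.add_sub_cancel' hk']
    ring
  · rw [if_neg h, if_neg (fun h' => h h'.1)]; simp

/-! ### Laplace transforms and their holomorphy -/

lemma integrableOn_rpow_mul_exp_neg_mul {σ r : ℝ} (hσ : -1 < σ) (hr : 0 < r) :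
    IntegrableOn (fun t : ℝ => t ^ σ * Real.exp (-r * t)) (Ioi 0) := by
  simpa using integrableOn_rpow_mul_exp_neg_mul_rpow hσ one_pos hr

lemma integrableOn_exp_neg_mul_mul {g : ℝ → ℂ} {C σ : ℝ}
    (hg : AEStronglyMeasurable g (volume.restrict (Ioi 0))) (hσ : -1 < σ)
    (hb : ∀ t, 0 < t → ‖g t‖ ≤ C * t ^ σ) {p : ℂ} (hp : 0 < p.re) :
    IntegrableOn (fun t : ℝ => Complex.exp (-p * t) * g t) (Ioi 0) := by
  refine Integrable.mono' ((integrableOn_rpow_mul_exp_neg_mul hσ hp).const_mul C)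
    ((Continuous.aestronglyMeasurable (by fun_prop)).mul hg) ?_
  refine (ae_restrict_iff' measurableSet_Ioi).2 (ae_of_all _ fun t ht => ?_)
  rw [norm_mul, Complex.norm_exp]
  have h1 : (-p * (t : ℂ)).re = -p.re * t := by simp
  rw [h1, mul_comm, ← mul_assoc]
  gcongr
  exact hb t ht

/-- A Laplace transform is holomorphic on the right half-plane. -/
lemma differentiableAt_integral_exp_neg_mul_mul {g : ℝ → ℂ} {C σ : ℝ}
    (hg : AEStronglyMeasurable g (volume.restrict (Ioi 0))) (hσ : -1 < σ)
    (hb : ∀ t, 0 < t → ‖g t‖ ≤ C * t ^ σ) {p : ℂ} (hp : 0 < p.re) :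
    DifferentiableAt ℂ (fun p : ℂ => ∫ t in Ioi (0 : ℝ), Complex.exp (-p * t) * g t) p := by
  -- On this neighbourhood `exp (-(Re p / 2) t)` dominates uniformly; differentiation in `z` adds
  -- the factor `t`, whence `σ + 1` below.
  have hs : {z : ℂ | p.re / 2 < z.re} ∈ 𝓝 p :=
    (isOpen_lt continuous_const Complex.continuous_re).mem_nhds (half_lt_self hp)
  refine (hasDerivAt_integral_of_dominated_loc_of_deriv_le
    (F := fun (z : ℂ) (t : ℝ) => Complex.exp (-z * t) * g t)
    (F' := fun (z : ℂ) (t : ℝ) => (Complex.exp (-z * t) * -t) * g t)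
    (bound := fun t => C * (t ^ (σ + 1) * Real.exp (-(p.re / 2) * t))) hs
    (Eventually.of_forall fun z => (Continuous.aestronglyMeasurable (by fun_prop)).mul hg)
    (integrableOn_exp_neg_mul_mul hg hσ hb hp)
    ((Continuous.aestronglyMeasurable (by fun_prop)).mul hg) ?_
    ((integrableOn_rpow_mul_exp_neg_mul (by linarith) (half_pos hp)).const_mul C)
    ?_).2.differentiableAt
  · refine (ae_restrict_iff' measurableSet_Ioi).2 (ae_of_all _ fun t ht z hz => ?_)
    have ht' : 0 < t := ht
    have h1 : (-z * (t : ℂ)).re = -z.re * t := by simp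
    rw [norm_mul, norm_mul, Complex.norm_exp, h1, norm_neg, Complex.norm_real, Real.norm_eq_abs,
      abs_of_pos ht']
    have h2 : Real.exp (-z.re * t) ≤ Real.exp (-(p.re / 2) * t) := by
      have : p.re / 2 < z.re := hz
      gcongr
    calc _ ≤ Real.exp (-(p.re / 2) * t) * t * (C * t ^ σ) :=
          mul_le_mul (by gcongr) (hb t ht) (norm_nonneg _) (by positivity)
      _ = _ := by rw [Real.rpow_add_one ht'.ne']; ring
  · refine ae_of_all _ fun t z _ => HasDerivAt.mul_const ?_ _
    have := ((hasDerivAt_id z).neg.mul_const (t : ℂ)).cexp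
    simpa using this

lemma besselJ_mul_ofReal (ν : ℂ) {a t : ℝ} (ha : 0 < a) (ht : 0 < t) :
    besselJ ν ((a : ℂ) * t) =
      ((a / 2 : ℝ) : ℂ) ^ ν * (t : ℂ) ^ ν * reducedBessel ν (a * t) := by
  rw [← Complex.ofReal_mul, besselJ_ofReal ν (mul_pos ha ht)]
  congr 1
  rw [← Complex.mul_cpow_ofReal_nonneg (by positivity) ht.le]
  congr 1
  push_cast; ring

lemma besselJ_mul_besselJ (ν : ℂ) {a b t : ℝ} (ha : 0 < a) (hb : 0 < b) (ht : 0 < t) :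
    besselJ ν ((a : ℂ) * t) * besselJ ν ((b : ℂ) * t) =
      ((a / 2 : ℝ) : ℂ) ^ ν * ((b / 2 : ℝ) : ℂ) ^ ν *
        ((t : ℂ) ^ (2 * ν) * (reducedBessel ν (a * t) * reducedBessel ν (b * t))) := by
  have ht0 : (t : ℂ) ≠ 0 := by exact_mod_cast ht.ne'
  rw [besselJ_mul_ofReal ν ha ht, besselJ_mul_ofReal ν hb ht, two_mul, Complex.cpow_add _ _ ht0]
  ring

lemma measurable_cpow_mul_reducedBessel {ν : ℂ} (hν : -(1 / 2 : ℝ) < ν.re) (a b : ℝ) :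
    Measurable fun t : ℝ => (t : ℂ) ^ (2 * ν) * (reducedBessel ν (a * t) *
      reducedBessel ν (b * t)) := by
  have hm := measurable_reducedBessel hν
  fun_prop

lemma aestronglyMeasurable_besselJ_mul_besselJ {ν : ℂ} (hν : -(1 / 2 : ℝ) < ν.re) {a b : ℝ}
    (ha : 0 < a) (hb : 0 < b) :
    AEStronglyMeasurable (fun t : ℝ => besselJ ν ((a : ℂ) * t) * besselJ ν ((b : ℂ) * t))
      (volume.restrict (Ioi 0)) := by
  refine ((measurable_cpow_mul_reducedBessel hν a b).const_mul
    (((a / 2 : ℝ) : ℂ) ^ ν * ((b / 2 : ℝ) : ℂ) ^ ν)).aestronglyMeasurable.congr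
    ((ae_restrict_iff' measurableSet_Ioi).2 (ae_of_all _ fun t ht => ?_))
  exact (besselJ_mul_besselJ ν ha hb ht).symm

lemma norm_besselJ_mul_besselJ_le {ν : ℂ} (hν : -(1 / 2 : ℝ) < ν.re) {a b : ℝ}
    (ha : 0 < a) (hb : 0 < b) {t : ℝ} (ht : 0 < t) :
    ‖besselJ ν ((a : ℂ) * t) * besselJ ν ((b : ℂ) * t)‖ ≤
      ‖((a / 2 : ℝ) : ℂ) ^ ν * ((b / 2 : ℝ) : ℂ) ^ ν‖ * reducedBesselBound ν ^ 2 *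
        t ^ (2 * ν.re) := by
  rw [besselJ_mul_besselJ ν ha hb ht, norm_mul, norm_mul ((t : ℂ) ^ (2 * ν)),
    Complex.norm_cpow_eq_rpow_re_of_pos ht, norm_mul (reducedBessel _ _), mul_assoc]
  have h2 : (2 * ν).re = 2 * ν.re := by simp
  rw [h2, mul_comm (reducedBesselBound ν ^ 2), sq]
  have := reducedBesselBound_nonneg ν
  gcongr <;> exact norm_reducedBessel_le hν _

/-! ### The Laplace transform at large real `p` -/

lemma cosh_le_exp {x : ℝ} (hx : 0 ≤ x) : Real.cosh x ≤ Real.exp x := by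
  rw [Real.cosh_eq]
  have : Real.exp (-x) ≤ Real.exp x := Real.exp_le_exp.2 (by linarith)
  linarith

lemma hasSum_reducedBesselTerm_mul {ν : ℂ} (hν : -(1 / 2 : ℝ) < ν.re) (s t : ℝ) :
    HasSum (fun q : ℕ × ℕ => reducedBesselTerm ν q.1 s * reducedBesselTerm ν q.2 t)
      (reducedBessel ν s * reducedBessel ν t) := by
  have s1 := summable_norm_reducedBesselTerm hν s
  have s2 := summable_norm_reducedBesselTerm hν t
  have h1 : HasSum (fun m => reducedBesselTerm ν m s) (reducedBessel ν s) := s1.of_norm.hasSum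
  have h2 : HasSum (fun m => reducedBesselTerm ν m t) (reducedBessel ν t) := s2.of_norm.hasSum
  have h3 : Summable fun q : ℕ × ℕ =>
      reducedBesselTerm ν q.1 s * reducedBesselTerm ν q.2 t :=
    summable_mul_of_summable_norm (f := fun m => reducedBesselTerm ν m s)
      (g := fun m => reducedBesselTerm ν m t) s1 s2
  exact HasSum.mul (f := fun m => reducedBesselTerm ν m s)
    (g := fun m => reducedBesselTerm ν m t) h1 h2 h3

/-- The termwise majorants sum to a multiple of `cosh (a t) cosh (b t) ≤ exp ((a + b) t)`, so
dominated convergence needs `p > a + b`. -/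
lemma hasSum_integral_reducedBesselTerm {ν : ℂ} (hν : -(1 / 2 : ℝ) < ν.re) {a b p : ℝ}
    (ha : 0 < a) (hb : 0 < b) (hp : a + b < p) :
    HasSum (fun q : ℕ × ℕ => ∫ t in Ioi (0 : ℝ), Complex.exp (-(p : ℂ) * t) *
        ((t : ℂ) ^ (2 * ν) *
          (reducedBesselTerm ν q.1 (a * t) * reducedBesselTerm ν q.2 (b * t))))
      (∫ t in Ioi (0 : ℝ), Complex.exp (-(p : ℂ) * t) * ((t : ℂ) ^ (2 * ν) *
        (reducedBessel ν (a * t) * reducedBessel ν (b * t)))) := by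
  have hB := reducedBesselBound_nonneg ν
  have hbs : ∀ t : ℝ, 0 < t → HasSum (fun q : ℕ × ℕ => Real.exp (-p * t) * (t ^ (2 * ν.re) *
      ((reducedBesselBound ν * (|a * t| ^ (2 * q.1) / (2 * q.1).factorial)) *
        (reducedBesselBound ν * (|b * t| ^ (2 * q.2) / (2 * q.2).factorial)))))
      (Real.exp (-p * t) * (t ^ (2 * ν.re) * ((reducedBesselBound ν * Real.cosh (a * t)) *
        (reducedBesselBound ν * Real.cosh (b * t))))) := by
    intro t ht
    have h1 := (Real.hasSum_cosh |a * t|).mul_left (reducedBesselBound ν)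
    have h2 := (Real.hasSum_cosh |b * t|).mul_left (reducedBesselBound ν)
    rw [Real.cosh_abs] at h1 h2
    exact ((h1.mul h2 (h1.summable.mul_of_nonneg h2.summable (fun _ => by positivity)
      fun _ => by positivity)).mul_left _).mul_left _
  refine hasSum_integral_of_dominated_convergence (fun q t => Real.exp (-p * t) *
    (t ^ (2 * ν.re) * ((reducedBesselBound ν * (|a * t| ^ (2 * q.1) / (2 * q.1).factorial)) *
      (reducedBesselBound ν * (|b * t| ^ (2 * q.2) / (2 * q.2).factorial))))) ?_ ?_ ?_ ?_ ?_
  · intro q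
    refine Measurable.aestronglyMeasurable ?_
    unfold reducedBesselTerm
    fun_prop
  · intro q
    refine (ae_restrict_iff' measurableSet_Ioi).2 (ae_of_all _ fun t ht => ?_)
    have ht' : 0 < t := ht
    have h1 : (-(p : ℂ) * (t : ℂ)).re = -p * t := by simp
    have h2 : (2 * ν).re = 2 * ν.re := by simp
    rw [norm_mul, norm_mul, norm_mul, Complex.norm_exp, h1,
      Complex.norm_cpow_eq_rpow_re_of_pos ht', h2]
    gcongr <;> exact norm_reducedBesselTerm_le hν _ _
  · exact (ae_restrict_iff' measurableSet_Ioi).2 (ae_of_all _ fun t ht => (hbs t ht).summable)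
  · have hi := (integrableOn_rpow_mul_exp_neg_mul (σ := 2 * ν.re) (r := p - a - b)
      (by linarith) (by linarith)).const_mul (reducedBesselBound ν ^ 2)
    have hm : AEStronglyMeasurable (fun t : ℝ => Real.exp (-p * t) * (t ^ (2 * ν.re) *
        ((reducedBesselBound ν * Real.cosh (a * t)) *
        (reducedBesselBound ν * Real.cosh (b * t))))) (volume.restrict (Ioi 0)) :=
      Measurable.aestronglyMeasurable (by fun_prop)
    refine (hi.mono' hm ?_).congr ?_
    · refine (ae_restrict_iff' measurableSet_Ioi).2 (ae_of_all _ fun t ht => ?_)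
      have ht' : 0 < t := ht
      have h1 := cosh_le_exp (mul_pos ha ht').le
      have h2 := cosh_le_exp (mul_pos hb ht').le
      have h3 := (Real.cosh_pos (a * t)).le
      have h4 := (Real.cosh_pos (b * t)).le
      rw [Real.norm_eq_abs, abs_of_nonneg (by positivity)]
      calc _ ≤ Real.exp (-p * t) * (t ^ (2 * ν.re) * ((reducedBesselBound ν * Real.exp (a * t)) *
            (reducedBesselBound ν * Real.exp (b * t)))) := by gcongr
        _ = reducedBesselBound ν ^ 2 * (t ^ (2 * ν.re) *
            (Real.exp (-p * t) * Real.exp (a * t) * Real.exp (b * t))) := by ring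
        _ = _ := by
          rw [← Real.exp_add, ← Real.exp_add]
          congr 3
          ring
    · exact (ae_restrict_iff' measurableSet_Ioi).2
        (ae_of_all _ fun t ht => (hbs t ht).tsum_eq.symm)
  · refine (ae_restrict_iff' measurableSet_Ioi).2 (ae_of_all _ fun t ht => ?_)
    exact ((hasSum_reducedBesselTerm_mul hν (a * t) (b * t)).mul_left _).mul_left _

/-- The integral is a gamma integral with value `Γ(2ν + 1 + 2(m + n))` up to a power of `p`;
duplication splits the resulting rising factorial into the two numerator factors. -/
lemma integral_reducedBesselTerm {ν : ℂ} (hν : -(1 / 2 : ℝ) < ν.re) (a b : ℝ) {p : ℝ}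
    (hp : 0 < p) (m n : ℕ) :
    ∫ t in Ioi (0 : ℝ), Complex.exp (-(p : ℂ) * t) * ((t : ℂ) ^ (2 * ν) *
      (reducedBesselTerm ν m (a * t) * reducedBesselTerm ν n (b * t))) =
    Complex.Gamma (2 * ν + 1) / Complex.Gamma (ν + 1) ^ 2 * (1 / (p : ℂ)) ^ (2 * ν + 1) *
      (risingFactorial (ν + 1 / 2) (m + n) * risingFactorial (ν + 1) (m + n) /
        (m.factorial * n.factorial * risingFactorial (ν + 1) m * risingFactorial (ν + 1) n) *
        (-((a : ℂ) / p) ^ 2) ^ m * (-((b : ℂ) / p) ^ 2) ^ n) := by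
  have hre : 0 < (2 * ν + 1).re := by norm_num at hν ⊢; linarith
  have hre1 : 0 < (ν + 1).re := by norm_num at hν ⊢; linarith
  have hpc : (p : ℂ) ≠ 0 := by exact_mod_cast hp.ne'
  have h1 := Complex.integral_cpow_mul_exp_neg_mul_Ioi
    (a := 2 * ν + 1 + (2 * (m + n) : ℕ)) (r := p) (by
      rw [Complex.add_re, Complex.natCast_re]
      positivity) hp
  have h2 : ∫ t in Ioi (0 : ℝ), Complex.exp (-(p : ℂ) * t) * ((t : ℂ) ^ (2 * ν) *
      (reducedBesselTerm ν m (a * t) * reducedBesselTerm ν n (b * t))) =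
      ((-1 : ℂ) ^ m / ((m.factorial : ℂ) * Complex.Gamma ((m : ℂ) + ν + 1)) *
        ((-1 : ℂ) ^ n / ((n.factorial : ℂ) * Complex.Gamma ((n : ℂ) + ν + 1))) *
        ((a : ℂ) / 2) ^ (2 * m) * ((b : ℂ) / 2) ^ (2 * n)) *
      ∫ t in Ioi (0 : ℝ), (t : ℂ) ^ (2 * ν + 1 + (2 * (m + n) : ℕ) - 1) *
        Complex.exp (-((p : ℂ) * t)) := by
    rw [← integral_const_mul]
    refine setIntegral_congr_fun measurableSet_Ioi fun t ht => ?_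
    have ht0 : (t : ℂ) ≠ 0 := by exact_mod_cast (ne_of_gt ht)
    simp only [reducedBesselTerm]
    rw [show 2 * ν + 1 + (2 * (m + n) : ℕ) - 1 = 2 * ν + (2 * (m + n) : ℕ) by ring,
      Complex.cpow_add _ _ ht0, Complex.cpow_natCast, neg_mul]
    push_cast
    ring
  rw [h2, h1, Gamma_add_natCast hre, risingFactorial_two_mul,
    show (2 * ν + 1) / 2 = ν + 1 / 2 by ring, show (2 * ν + 1 + 1) / 2 = ν + 1 by ring,
    show (m : ℂ) + ν + 1 = ν + 1 + m by ring, show (n : ℂ) + ν + 1 = ν + 1 + n by ring,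
    Gamma_add_natCast hre1, Gamma_add_natCast hre1, Complex.cpow_add _ _ (one_div_ne_zero hpc),
    Complex.cpow_natCast]
  have hG : Complex.Gamma (ν + 1) ≠ 0 := Complex.Gamma_ne_zero_of_re_pos hre1
  have hc : 1 / 2 < (ν + 1).re := by norm_num at hν ⊢; linarith
  have e1 := risingFactorial_ne_zero hc m
  have e2 := risingFactorial_ne_zero hc n
  have f1 : (m.factorial : ℂ) ≠ 0 := by exact_mod_cast m.factorial_ne_zero
  have f2 : (n.factorial : ℂ) ≠ 0 := by exact_mod_cast n.factorial_ne_zero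
  have h4 : (4 : ℂ) ^ (m + n) = 2 ^ (2 * m) * 2 ^ (2 * n) := by
    rw [← pow_add, ← mul_add, pow_mul]; norm_num
  rw [h4, neg_pow (((a : ℂ) / p) ^ 2), neg_pow (((b : ℂ) / p) ^ 2), mul_add 2 m n, pow_add]
  simp only [div_pow, ← pow_mul, one_pow]
  generalize risingFactorial (ν + 1) m = r1 at e1 ⊢
  generalize risingFactorial (ν + 1) n = r2 at e2 ⊢
  generalize risingFactorial (ν + 1) (m + n) = r3
  generalize risingFactorial (ν + 1 / 2) (m + n) = r4
  generalize (1 / (p : ℂ)) ^ (2 * ν + 1) = P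
  generalize Complex.Gamma (2 * ν + 1) = G
  generalize Complex.Gamma (ν + 1) = G1 at hG ⊢
  field_simp

lemma tsum_risingFactorial_mul_cpow (α c : ℂ) {x y : ℂ} (h : 1 - (x + y) ≠ 0) :
    ∑' k : ℕ, risingFactorial α (2 * k) / (k.factorial * risingFactorial c k) * (x * y) ^ k *
        (1 - (x + y)) ^ (-(α + (2 * k : ℕ))) =
      (1 - (x + y)) ^ (-α) * ordinaryHypergeometric (α / 2) ((α + 1) / 2) c
        (4 * (x * y) / (1 - (x + y)) ^ 2) := by
  rw [ordinaryHypergeometric_eq_tsum, ← tsum_mul_left]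
  refine tsum_congr fun k => ?_
  rw [neg_add, Complex.cpow_add _ _ h, Complex.cpow_neg _ ((2 * k : ℕ) : ℂ), Complex.cpow_natCast,
    risingFactorial_two_mul, smul_eq_mul, div_pow, mul_pow, ← pow_mul]
  simp only [risingFactorial, div_eq_mul_inv, mul_inv]
  ring

/-- The right-hand side of the Laplace transform formula for `J_ν(a t) J_ν(b t)`. -/
noncomputable def besselLaplace (ν : ℂ) (a b : ℝ) (p : ℂ) : ℂ :=
  1 / (√Real.pi : ℂ) * (1 / ((a : ℂ) ^ 2 + (b : ℂ) ^ 2 + p ^ 2) ^ (1 / 2 : ℂ)) *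
    (Complex.Gamma (1 / 2 + ν) / Complex.Gamma (1 + ν)) *
    ((a : ℂ) * (b : ℂ) / ((a : ℂ) ^ 2 + (b : ℂ) ^ 2 + p ^ 2)) ^ ν *
    ordinaryHypergeometric ((1 + 2 * ν) / 4) ((3 + 2 * ν) / 4) (1 + ν)
      ((2 * (a : ℂ) * (b : ℂ) / ((a : ℂ) ^ 2 + (b : ℂ) ^ 2 + p ^ 2)) ^ 2)

lemma ofReal_cpow_eq_exp {r : ℝ} (hr : 0 < r) (w : ℂ) :
    (r : ℂ) ^ w = Complex.exp (Real.log r * w) := by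
  rw [Complex.cpow_def_of_ne_zero (by exact_mod_cast hr.ne'), Complex.ofReal_log hr.le]

/-- All bases are positive reals, so principal powers are exponentials of real logarithms and the
identity is linear in those logarithms. No branch question arises, as complex `p` is reached only by
continuation. -/
lemma bessel_prefactor_cpow (ν : ℂ) {a b p s : ℝ} (ha : 0 < a) (hb : 0 < b) (hp : 0 < p)
    (hs : 0 < s) :
    ((a / 2 : ℝ) : ℂ) ^ ν * ((b / 2 : ℝ) : ℂ) ^ ν * ((1 / p : ℝ) : ℂ) ^ (2 * ν + 1) *
      ((s / p ^ 2 : ℝ) : ℂ) ^ (-(ν + 1 / 2)) =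
    ((2 : ℝ) : ℂ) ^ (-(2 * ν)) * (((s : ℝ) : ℂ) ^ (1 / 2 : ℂ))⁻¹ * ((a * b / s : ℝ) : ℂ) ^ ν := by
  rw [← Complex.cpow_neg, ofReal_cpow_eq_exp (by positivity), ofReal_cpow_eq_exp (by positivity),
    ofReal_cpow_eq_exp (by positivity), ofReal_cpow_eq_exp (by positivity),
    ofReal_cpow_eq_exp two_pos, ofReal_cpow_eq_exp hs, ofReal_cpow_eq_exp (by positivity),
    Real.log_div ha.ne' two_ne_zero, Real.log_div hb.ne' two_ne_zero,
    Real.log_div one_ne_zero hp.ne', Real.log_div hs.ne' (by positivity),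
    Real.log_div (by positivity) hs.ne', Real.log_mul ha.ne' hb.ne', Real.log_pow, Real.log_one]
  simp only [← Complex.exp_add]
  congr 1
  push_cast
  ring

lemma Gamma_two_mul_add_one_div {ν : ℂ} (hν : -(1 / 2 : ℝ) < ν.re) :
    Complex.Gamma (2 * ν + 1) / Complex.Gamma (ν + 1) ^ 2 * (2 : ℂ) ^ (-(2 * ν)) =
      1 / (√Real.pi : ℂ) * (Complex.Gamma (1 / 2 + ν) / Complex.Gamma (1 + ν)) := by
  have h := Complex.Gamma_mul_Gamma_add_half (1 / 2 + ν)
  rw [show 1 / 2 + ν + 1 / 2 = ν + 1 by ring, show 2 * (1 / 2 + ν) = 2 * ν + 1 by ring,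
    show 1 - (2 * ν + 1) = -(2 * ν) by ring] at h
  have hG : Complex.Gamma (ν + 1) ≠ 0 := Complex.Gamma_ne_zero_of_re_pos (by
    norm_num at hν ⊢; linarith)
  have hpi : (√Real.pi : ℂ) ≠ 0 := by exact_mod_cast (Real.sqrt_pos.2 Real.pi_pos).ne'
  rw [add_comm 1 ν]
  generalize Complex.Gamma (ν + 1) = G at h hG ⊢
  generalize Complex.Gamma (2 * ν + 1) = G2 at h ⊢
  generalize Complex.Gamma (1 / 2 + ν) = G3 at h ⊢
  generalize (2 : ℂ) ^ (-(2 * ν)) = T at h ⊢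
  field_simp
  linear_combination -h

lemma laplace_besselJ_mul_besselJ_of_large {ν : ℂ} (hν : -(1 / 2 : ℝ) < ν.re) {a b p : ℝ}
    (ha : 0 < a) (hb : 0 < b) (hp : 16 * (a + b) < p) :
    ∫ t in Ioi (0 : ℝ), Complex.exp (-(p : ℂ) * t) *
      (besselJ ν ((a : ℂ) * t) * besselJ ν ((b : ℂ) * t)) = besselLaplace ν a b p := by
  have hp0 : 0 < p := by linarith
  have hpc : (p : ℂ) ≠ 0 := by exact_mod_cast hp0.ne'
  have hc : 1 / 2 < (ν + 1).re := by norm_num at hν ⊢; linarith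
  -- The factor `16` gives `(d / p)² < 1/256`, more than the `1/16` required for the triple series.
  have hsmall : ∀ d : ℝ, 0 < d → 16 * d < p → ‖-((d : ℂ) / p) ^ 2‖ < 1 / 16 := by
    intro d hd hdp
    rw [norm_neg, norm_pow, norm_div, Complex.norm_real, Complex.norm_real, Real.norm_eq_abs,
      Real.norm_eq_abs, abs_of_pos hd, abs_of_pos hp0]
    have h1 : d / p < 1 / 16 := by rw [div_lt_iff₀ hp0]; linarith
    have h2 : 0 < d / p := by positivity
    nlinarith
  have hs := (hasSum_integral_reducedBesselTerm hν ha hb (p := p) (by linarith))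
  simp only [integral_reducedBesselTerm hν a b hp0] at hs
  have hd := hasSum_double_risingFactorial (ν + 1 / 2) hc (hsmall a ha (by linarith))
    (hsmall b hb (by linarith))
  have h1 := hs.unique (hd.mul_left _)
  have hI : ∫ t in Ioi (0 : ℝ), Complex.exp (-(p : ℂ) * t) *
      (besselJ ν ((a : ℂ) * t) * besselJ ν ((b : ℂ) * t)) =
      ((a / 2 : ℝ) : ℂ) ^ ν * ((b / 2 : ℝ) : ℂ) ^ ν * ∫ t in Ioi (0 : ℝ),
        Complex.exp (-(p : ℂ) * t) * ((t : ℂ) ^ (2 * ν) *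
        (reducedBessel ν (a * t) * reducedBessel ν (b * t))) := by
    rw [← integral_const_mul]
    refine setIntegral_congr_fun measurableSet_Ioi fun t ht => ?_
    rw [besselJ_mul_besselJ ν ha hb ht]
    ring
  have hsp : 0 < a ^ 2 + b ^ 2 + p ^ 2 := by positivity
  have hsc : (a : ℂ) ^ 2 + (b : ℂ) ^ 2 + (p : ℂ) ^ 2 ≠ 0 := by exact_mod_cast hsp.ne'
  have hx : 1 - (-((a : ℂ) / p) ^ 2 + -((b : ℂ) / p) ^ 2) =
      (((a ^ 2 + b ^ 2 + p ^ 2) / p ^ 2 : ℝ) : ℂ) := by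
    push_cast
    field_simp
    ring
  have hx0 : 1 - (-((a : ℂ) / p) ^ 2 + -((b : ℂ) / p) ^ 2) ≠ 0 := by
    rw [hx]
    exact_mod_cast (div_pos hsp (by positivity : 0 < p ^ 2)).ne'
  rw [hI, h1, tsum_risingFactorial_mul_cpow _ _ hx0, hx]
  have harg : 4 * (-((a : ℂ) / p) ^ 2 * -((b : ℂ) / p) ^ 2) /
      (((a ^ 2 + b ^ 2 + p ^ 2) / p ^ 2 : ℝ) : ℂ) ^ 2 =
      (2 * (a : ℂ) * (b : ℂ) / ((a : ℂ) ^ 2 + (b : ℂ) ^ 2 + (p : ℂ) ^ 2)) ^ 2 := by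
    push_cast
    field_simp
    ring
  have hpre := bessel_prefactor_cpow ν ha hb hp0 hsp
  have hG := Gamma_two_mul_add_one_div hν
  rw [harg, show (ν + 1 / 2) / 2 = (1 + 2 * ν) / 4 by ring,
    show (ν + 1 / 2 + 1) / 2 = (3 + 2 * ν) / 4 by ring, besselLaplace, add_comm 1 ν]
  rw [add_comm 1 ν] at hG
  generalize ordinaryHypergeometric ((1 + 2 * ν) / 4) ((3 + 2 * ν) / 4) (ν + 1)
      ((2 * (a : ℂ) * (b : ℂ) / ((a : ℂ) ^ 2 + (b : ℂ) ^ 2 + (p : ℂ) ^ 2)) ^ 2) = H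
  rw [show (1 / (p : ℂ)) = ((1 / p : ℝ) : ℂ) by push_cast; rfl]
  have e1 : ((a ^ 2 + b ^ 2 + p ^ 2 : ℝ) : ℂ) = (a : ℂ) ^ 2 + (b : ℂ) ^ 2 + (p : ℂ) ^ 2 := by
    push_cast; rfl
  have e2 : ((a * b / (a ^ 2 + b ^ 2 + p ^ 2) : ℝ) : ℂ) =
      (a : ℂ) * b / ((a : ℂ) ^ 2 + (b : ℂ) ^ 2 + (p : ℂ) ^ 2) := by push_cast; rfl
  rw [e1, e2, Complex.ofReal_ofNat] at hpre
  calc _ = Complex.Gamma (2 * ν + 1) / Complex.Gamma (ν + 1) ^ 2 *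
      (((a / 2 : ℝ) : ℂ) ^ ν * ((b / 2 : ℝ) : ℂ) ^ ν * ((1 / p : ℝ) : ℂ) ^ (2 * ν + 1) *
      (((a ^ 2 + b ^ 2 + p ^ 2) / p ^ 2 : ℝ) : ℂ) ^ (-(ν + 1 / 2))) * H := by ring
    _ = (Complex.Gamma (2 * ν + 1) / Complex.Gamma (ν + 1) ^ 2 * (2 : ℂ) ^ (-(2 * ν))) *
      ((((a : ℂ) ^ 2 + (b : ℂ) ^ 2 + (p : ℂ) ^ 2) ^ (1 / 2 : ℂ))⁻¹ *
      ((a : ℂ) * b / ((a : ℂ) ^ 2 + (b : ℂ) ^ 2 + (p : ℂ) ^ 2)) ^ ν) * H := by rw [hpre]; ring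
    _ = _ := by rw [hG]; ring

/-! ### Analytic continuation to the sector -/

lemma differentiableAt_ordinaryHypergeometric {α β γ z : ℂ}
    (h : ∀ n : ℕ, (n : ℂ) ≠ -α ∧ (n : ℂ) ≠ -β ∧ (n : ℂ) ≠ -γ) (hz : ‖z‖ < 1) :
    DifferentiableAt ℂ (ordinaryHypergeometric α β γ : ℂ → ℂ) z := by
  have hr := ordinaryHypergeometricSeries_radius_eq_one ℂ α β γ h
  have hf := (ordinaryHypergeometricSeries ℂ α β γ).hasFPowerSeriesOnBall (by rw [hr]; simp)
  refine (hf.analyticAt_of_mem ?_).differentiableAt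
  rw [hr]
  simpa [enorm_eq_nnnorm] using (by exact_mod_cast hz : ‖z‖₊ < 1)

lemma natCast_ne_neg_of_re_pos {z : ℂ} (hz : 0 < z.re) (n : ℕ) : (n : ℂ) ≠ -z := by
  intro h
  have := congrArg Complex.re h
  rw [Complex.natCast_re, Complex.neg_re] at this
  have h0 : (0 : ℝ) ≤ n := n.cast_nonneg
  linarith

lemma re_sq_pos {p : ℂ} (hp : |p.im| < p.re) : 0 < (p ^ 2).re := by
  have h0 := abs_nonneg p.im
  have h1 : p.im ^ 2 < p.re ^ 2 := sq_lt_sq' (by linarith [neg_abs_le p.im])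
    ((le_abs_self _).trans_lt hp)
  rw [sq, Complex.mul_re]
  nlinarith

/-- On the sector `Re p² > 0`, so `s = a² + b² + p²` has `|s| ≥ Re s > a² + b² ≥ 2ab`: the bases of
the powers stay in the right half-plane and the hypergeometric argument in the unit disc. -/
lemma differentiableAt_besselLaplace {ν : ℂ} (hν : -(1 / 2 : ℝ) < ν.re) {a b : ℝ}
    (ha : 0 < a) (hb : 0 < b) {p : ℂ} (hp : |p.im| < p.re) :
    DifferentiableAt ℂ (besselLaplace ν a b) p := by
  have hq := re_sq_pos hp
  have hre : ((a : ℂ) ^ 2 + (b : ℂ) ^ 2 + p ^ 2).re = a ^ 2 + b ^ 2 + (p ^ 2).re := by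
    rw [Complex.add_re, Complex.add_re, ← Complex.ofReal_pow, ← Complex.ofReal_pow,
      Complex.ofReal_re, Complex.ofReal_re]
  have hs : 0 < ((a : ℂ) ^ 2 + (b : ℂ) ^ 2 + p ^ 2).re := by rw [hre]; positivity
  have hs0 : (a : ℂ) ^ 2 + (b : ℂ) ^ 2 + p ^ 2 ≠ 0 := fun h => by
    rw [h, Complex.zero_re] at hs; exact hs.false
  have hd : DifferentiableAt ℂ (fun p : ℂ => (a : ℂ) ^ 2 + (b : ℂ) ^ 2 + p ^ 2) p := by fun_prop
  have hnorm : ‖(2 * (a : ℂ) * (b : ℂ) / ((a : ℂ) ^ 2 + (b : ℂ) ^ 2 + p ^ 2)) ^ 2‖ < 1 := by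
    rw [norm_pow]
    refine pow_lt_one₀ (norm_nonneg _) ?_ two_ne_zero
    rw [norm_div, div_lt_one (norm_pos_iff.2 hs0), norm_mul, norm_mul, Complex.norm_real,
      Complex.norm_real, Complex.norm_ofNat, Real.norm_eq_abs, Real.norm_eq_abs, abs_of_pos ha,
      abs_of_pos hb]
    refine lt_of_lt_of_le ?_ (Complex.re_le_norm _)
    rw [hre]
    nlinarith [sq_nonneg (a - b)]
  have hF := differentiableAt_ordinaryHypergeometric (α := (1 + 2 * ν) / 4)
    (β := (3 + 2 * ν) / 4) (γ := 1 + ν) (fun n => ⟨natCast_ne_neg_of_re_pos (by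
      norm_num at hν ⊢; linarith) n, natCast_ne_neg_of_re_pos (by
      norm_num at hν ⊢; linarith) n, natCast_ne_neg_of_re_pos (by
      norm_num at hν ⊢; linarith) n⟩) hnorm
  have h1 : DifferentiableAt ℂ
      (fun p : ℂ => 1 / ((a : ℂ) ^ 2 + (b : ℂ) ^ 2 + p ^ 2) ^ (1 / 2 : ℂ)) p := by
    refine (differentiableAt_const _).div
      (hd.cpow (differentiableAt_const _) (Or.inl hs)) ?_
    rw [Complex.cpow_def_of_ne_zero hs0]
    exact Complex.exp_ne_zero _
  have h2 : DifferentiableAt ℂ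
      (fun p : ℂ => ((a : ℂ) * (b : ℂ) / ((a : ℂ) ^ 2 + (b : ℂ) ^ 2 + p ^ 2)) ^ ν) p := by
    refine ((differentiableAt_const _).div hd hs0).cpow (differentiableAt_const _) (Or.inl ?_)
    change 0 < ((a : ℂ) * b / ((a : ℂ) ^ 2 + (b : ℂ) ^ 2 + p ^ 2)).re
    rw [← Complex.ofReal_mul, div_eq_mul_inv, Complex.re_ofReal_mul, Complex.inv_re]
    have : 0 < Complex.normSq ((a : ℂ) ^ 2 + (b : ℂ) ^ 2 + p ^ 2) := Complex.normSq_pos.2 hs0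
    positivity
  have h3 : DifferentiableAt ℂ
      (fun p : ℂ => (2 * (a : ℂ) * (b : ℂ) / ((a : ℂ) ^ 2 + (b : ℂ) ^ 2 + p ^ 2)) ^ 2) p :=
    ((differentiableAt_const _).div hd hs0).pow 2
  exact (((h1.const_mul _).mul_const _).mul h2).mul (hF.comp p h3)

lemma isOpen_abs_im_lt_re : IsOpen {p : ℂ | |p.im| < p.re} :=
  isOpen_lt (by fun_prop) (by fun_prop)

lemma convex_abs_im_lt_re : Convex ℝ {p : ℂ | |p.im| < p.re} := by
  have h : {p : ℂ | |p.im| < p.re} = {p : ℂ | 0 < p.re - p.im} ∩ {p : ℂ | 0 < p.re + p.im} := by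
    ext p
    simp only [mem_ofPred_eq, mem_inter_iff, abs_lt]
    constructor <;> rintro ⟨h1, h2⟩ <;> constructor <;> linarith
  rw [h]
  exact (convex_halfSpace_gt (Complex.reLm - Complex.imLm).isLinear 0).inter
    (convex_halfSpace_gt (Complex.reLm + Complex.imLm).isLinear 0)

/-- The Laplace transform of `t ↦ J_ν(a t) J_ν(b t)`. -/
lemma laplace_besselJ_mul_besselJ {ν : ℂ} (hν : -(1 / 2 : ℝ) < ν.re) {a b : ℝ}
    (ha : 0 < a) (hb : 0 < b) {p : ℂ} (hp : |p.im| < p.re) :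
    ∫ t in Ioi (0 : ℝ), Complex.exp (-p * t) *
      (besselJ ν ((a : ℂ) * t) * besselJ ν ((b : ℂ) * t)) = besselLaplace ν a b p := by
  have hL : AnalyticOnNhd ℂ (fun p : ℂ => ∫ t in Ioi (0 : ℝ), Complex.exp (-p * t) *
      (besselJ ν ((a : ℂ) * t) * besselJ ν ((b : ℂ) * t))) {p : ℂ | |p.im| < p.re} :=
    DifferentiableOn.analyticOnNhd (fun z hz => (differentiableAt_integral_exp_neg_mul_mul
      (aestronglyMeasurable_besselJ_mul_besselJ hν ha hb) (by linarith)
      (fun t ht => norm_besselJ_mul_besselJ_le hν ha hb ht)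
      ((abs_nonneg _).trans_lt hz)).differentiableWithinAt) isOpen_abs_im_lt_re
  have hR : AnalyticOnNhd ℂ (besselLaplace ν a b) {p : ℂ | |p.im| < p.re} :=
    DifferentiableOn.analyticOnNhd (fun z hz =>
      (differentiableAt_besselLaplace hν ha hb hz).differentiableWithinAt) isOpen_abs_im_lt_re
  let P : ℝ := 16 * (a + b) + 1
  have hP : (P : ℂ) ∈ {p : ℂ | |p.im| < p.re} := by
    simp only [mem_ofPred_eq, Complex.ofReal_im, Complex.ofReal_re, abs_zero, P]
    positivity
  refine hL.eqOn_of_preconnected_of_frequently_eq hR convex_abs_im_lt_re.isPreconnected hP ?_ hp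
  -- Agreement is known only at real points, but these accumulate at `P`, which suffices for the
  -- identity theorem.
  have hreal : ∃ᶠ x : ℝ in 𝓝[≠] P, 16 * (a + b) < x :=
    (eventually_nhdsWithin_of_eventually_nhds
      (eventually_gt_nhds (lt_add_one (16 * (a + b))))).frequently
  have ht : Tendsto (fun x : ℝ => (x : ℂ)) (𝓝[≠] P) (𝓝[≠] (P : ℂ)) :=
    tendsto_nhdsWithin_of_tendsto_nhds_of_eventually_within _
      (Complex.continuous_ofReal.continuousAt.tendsto.mono_left nhdsWithin_le_nhds)
      (eventually_nhdsWithin_of_forall fun x hx => by simpa using hx)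
  exact ht.frequently (hreal.mono fun x hx => laplace_besselJ_mul_besselJ_of_large hν ha hb hx)

/-! ### The quadratic substitution -/

lemma abs_im_lt_re_of_abs_arg_lt {p : ℂ} (hp0 : p ≠ 0) (hp : |p.arg| < Real.pi / 4) :
    |p.im| < p.re := by
  obtain ⟨h1, h2⟩ := abs_lt.1 hp
  have hn : 0 < ‖p‖ := norm_pos_iff.2 hp0
  have hc : 0 < Real.cos p.arg := Real.cos_pos_of_mem_Ioo ⟨by linarith, by linarith⟩
  have hc2 : 0 < Real.cos (2 * p.arg) := Real.cos_pos_of_mem_Ioo ⟨by linarith, by linarith⟩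
  rw [Real.cos_two_mul', sub_pos] at hc2
  have h3 : |Real.sin p.arg| < Real.cos p.arg := abs_lt_of_sq_lt_sq hc2 hc.le
  rw [← Complex.norm_mul_cos_arg p, ← Complex.norm_mul_sin_arg p, abs_mul, abs_of_pos hn]
  exact mul_lt_mul_of_pos_left h3 hn

theorem mainTheorem2 (ν p : ℂ) (a b : ℝ) (hν : -(1 / 2 : ℝ) < ν.re)
    (hp0 : p ≠ 0) (hp : |p.arg| < Real.pi / 4) (ha : 0 < a) (hb : 0 < b) :
    MeasureTheory.IntegrableOn
        (fun x : ℝ => (x : ℂ) * Complex.exp (-p * (x : ℂ) ^ 2) *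
          besselJ ν ((a : ℂ) * (x : ℂ) ^ 2) * besselJ ν ((b : ℂ) * (x : ℂ) ^ 2))
        (Set.Ioi 0) MeasureTheory.volume ∧
      ∫ x in Set.Ioi (0 : ℝ), (x : ℂ) * Complex.exp (-p * (x : ℂ) ^ 2) *
          besselJ ν ((a : ℂ) * (x : ℂ) ^ 2) * besselJ ν ((b : ℂ) * (x : ℂ) ^ 2) =
        1 / (2 * (Real.sqrt Real.pi : ℂ)) *
          (1 / ((a : ℂ) ^ 2 + (b : ℂ) ^ 2 + p ^ 2) ^ (1 / 2 : ℂ)) *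
          (Complex.Gamma (1 / 2 + ν) / Complex.Gamma (1 + ν)) *
          ((a : ℂ) * (b : ℂ) / ((a : ℂ) ^ 2 + (b : ℂ) ^ 2 + p ^ 2)) ^ ν *
          ordinaryHypergeometric ((1 + 2 * ν) / 4) ((3 + 2 * ν) / 4) (1 + ν)
            ((2 * (a : ℂ) * (b : ℂ) / ((a : ℂ) ^ 2 + (b : ℂ) ^ 2 + p ^ 2)) ^ 2) := by
  have hp' := abs_im_lt_re_of_abs_arg_lt hp0 hp
  let G : ℝ → ℂ := fun t => Complex.exp (-p * t) *
    (besselJ ν ((a : ℂ) * t) * besselJ ν ((b : ℂ) * t))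
  have hG : IntegrableOn G (Ioi 0) :=
    integrableOn_exp_neg_mul_mul (aestronglyMeasurable_besselJ_mul_besselJ hν ha hb)
      (by linarith) (fun t ht => norm_besselJ_mul_besselJ_le hν ha hb ht)
      ((abs_nonneg _).trans_lt hp')
  -- The integrand is put in the form `x ^ (2 - 1) • G (x ^ 2)` of the power substitution; its
  -- Jacobian constant `2` supplies the factor `1/2` in the result.
  have hpt : ∀ x : ℝ, (x : ℂ) * Complex.exp (-p * (x : ℂ) ^ 2) *
      besselJ ν ((a : ℂ) * (x : ℂ) ^ 2) * besselJ ν ((b : ℂ) * (x : ℂ) ^ 2) =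
      (x ^ ((2 : ℝ) - 1)) • G (x ^ (2 : ℝ)) := by
    intro x
    have h1 : (2 : ℝ) - 1 = 1 := by norm_num
    rw [h1, Real.rpow_one, Real.rpow_two, Complex.real_smul]
    simp only [G]
    push_cast
    ring
  simp only [hpt]
  refine ⟨(integrableOn_Ioi_comp_rpow_iff' G two_ne_zero).2 hG, ?_⟩
  have h2 := integral_comp_rpow_Ioi_of_pos (g := G) (p := 2) two_pos
  simp only [mul_smul] at h2
  rw [integral_smul, laplace_besselJ_mul_besselJ hν ha hb hp', besselLaplace,
    Complex.real_smul] at h2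
  have h3 : ∀ I R : ℂ, ((2 : ℝ) : ℂ) * I = R → I = 1 / 2 * R := by
    rintro I R rfl
    push_cast; ring
  rw [h3 _ _ h2, show (1 : ℂ) / (2 * (√Real.pi : ℂ)) = 1 / 2 * (1 / (√Real.pi : ℂ)) by ring]
  ring
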